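/- Let $L\ge 2$ and $I\ge 2$. For $i=1,\dots,I$ let $u_i:\mathbb{R}^L_+\to\mathbb{R}_+$ be a utility function that is continuous on $\mathbb{R}^L_+$, $C^\infty$ with nowhere vanishing gradient on $\mathbb{R}^L_{++}$, non-decreasing, strictly quasi-concave on $\mathbb{R}^L_{++}$ (that is, $u_i(ac+(1-a)d)>\min\{u_i(c),u_i(d)\}$ for distinct $c,d\in\mathbb{R}^L_{++}$ and $0<a<1$), unbounded, without local maxima on $\mathbb{R}^L_+$, and with $u_i(0)=0$. Assume moreover that there are no corner solutions: for all $p\in\mathbb{R}^L_{++}$ and $w>0$, every maximizer of $u_i$ on the budget set $\{c\in\mathbb{R}^L_+ : p\cdot c\le w\}$ lies in $\mathbb{R}^L_{++}$. Then, for each $i$, the Walrasian demand $x_i(p,w)=\arg\max\{u_i(c): c\in\mathbb{R}^L_+,\ p\cdot c\le w\}$ ($p\in\mathbb{R}^L_{++}$, $w>0$) and the Hicksian demand $h_i(p,t)=\arg\min\{p\cdot c : c\in\mathbb{R}^L_+,\ u_i(c)\ge t\}$ ($p\in\mathbb{R}^L_{++}$, $t>0$) exist and are unique. Write $v_{ni}(p)=u_i(x_i(p,1))$.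 Say that an allocation $y=(y_1,\dots,y_I)\in\mathbb{R}^{IL}_{++}$ (each $y_i\in\mathbb{R}^L_{++}$) Pareto dominates an allocation $z\in\mathbb{R}^{IL}_{++}$ if $u_i(y_i)\ge u_i(z_i)$ for all $i$, with at least one strict inequality, and $\sum_i y_i=\sum_i z_i$. Let $\mathcal{P}\subseteq\mathbb{R}^{IL}_{++}$ be the set of Pareto optimal allocations, i.e. of the allocations in $\mathbb{R}^{IL}_{++}$ that no allocation in $\mathbb{R}^{IL}_{++}$ Pareto dominates. (No aggregate resource constraint is imposed explicitly.) Then $$\mathcal{P}=\{(h_1((q,1),t_1),\dots,h_I((q,1),t_I)) : q\in\mathbb{R}^{L-1}_{++},\ t_1,\dots,t_I>0\}$$ $$=\{(h_1((q,1),v_{n1}((q,1)/w_1)),\dots,h_I((q,1),v_{nI}((q,1)/w_I))) : q\in\mathbb{R}^{L-1}_{++},\ w_1,\dots,w_I>0\},$$ and $\mathcal{P}$ is nonempty, connected and, with the subspace topology, a topological manifold without boundary of dimension $L+I-1\ge 3$. If in addition every $u_i$ satisfies the bordered Hessian condition, i.e. $v^{T}D^2u_i(c)\,v<0$ for all $c\in\mathbb{R}^L_{++}$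 and all $v\ne 0$ with $\nabla u_i(c)\cdot v=0$, then $\mathcal{P}$ is an embedded $C^\infty$ submanifold of $\mathbb{R}^{IL}$ without boundary, of dimension $L+I-1$. -/

import Mathlib

open scoped ContDiff

/-- The closed orthant `ℝ^L_+`. -/
def orthant (L : ℕ) : Set (Fin L → ℝ) := {c | ∀ l, 0 ≤ c l}

/-- The open orthant `ℝ^L_{++}`. -/
def posOrthant (L : ℕ) : Set (Fin L → ℝ) := {c | ∀ l, 0 < c l}

/-- The budget set `B(p, w) = {c ∈ ℝ^L_+ | p ⬝ c ≤ w}`. -/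
def budgetSet {L : ℕ} (p : Fin L → ℝ) (w : ℝ) : Set (Fin L → ℝ) :=
  {c | c ∈ orthant L ∧ p ⬝ᵥ c ≤ w}

/-- `c` solves the utility maximization problem at prices `p` and wealth `w`. -/
def IsWalrasian {L : ℕ} (u : (Fin L → ℝ) → ℝ) (p : Fin L → ℝ) (w : ℝ) (c : Fin L → ℝ) : Prop :=
  c ∈ budgetSet p w ∧ ∀ d ∈ budgetSet p w, u d ≤ u c

/-- `c` solves the expenditure minimization problem at prices `p` and utility level `t`. -/
def IsHicksian {L : ℕ} (u : (Fin L → ℝ) → ℝ) (p : Fin L → ℝ) (t : ℝ) (c : Fin L → ℝ) : Prop :=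
  (c ∈ orthant L ∧ t ≤ u c) ∧ ∀ d ∈ orthant L, t ≤ u d → p ⬝ᵥ c ≤ p ⬝ᵥ d

open Classical in
/-- The Walrasian demand function `x(p, w)` (the value is `0` if there is no solution). -/
noncomputable def walras {L : ℕ} (u : (Fin L → ℝ) → ℝ) (p : Fin L → ℝ) (w : ℝ) : Fin L → ℝ :=
  if h : ∃ c, IsWalrasian u p w c then h.choose else 0

open Classical in
/-- The Hicksian demand function `h(p, t)` (the value is `0` if there is no solution). -/
noncomputable def hicks {L : ℕ} (u : (Fin L → ℝ) → ℝ) (p : Fin L → ℝ) (t : ℝ) : Fin L → ℝ :=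
  if h : ∃ c, IsHicksian u p t c then h.choose else 0

/-- The normalized Walrasian demand `x_n(p) = x(p, 1)`. -/
noncomputable def normWalras {L : ℕ} (u : (Fin L → ℝ) → ℝ) (p : Fin L → ℝ) : Fin L → ℝ :=
  walras u p 1

/-- The normalized indirect utility `v_n(p) = u(x_n(p))`. -/
noncomputable def normIndirect {L : ℕ} (u : (Fin L → ℝ) → ℝ) (p : Fin L → ℝ) : ℝ :=
  u (normWalras u p)

/-- The price vector `(q, 1)`, for `q ∈ ℝ^{L-1}`. -/
def withNumeraire {L : ℕ} (q : Fin (L - 1) → ℝ) : Fin L → ℝ :=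
  fun l => if h : l.val < L - 1 then q ⟨l.val, h⟩ else 1

/-- The assumptions on a consumer's utility function. Only the values of `u` on `ℝ^L_+` matter. -/
structure IsUtility {L : ℕ} (u : (Fin L → ℝ) → ℝ) : Prop where
  nonneg : ∀ c ∈ orthant L, 0 ≤ u c
  zero : u 0 = 0
  continuousOn : ContinuousOn u (orthant L)
  smooth : ContDiffOn ℝ ∞ u (posOrthant L)
  monotone : MonotoneOn u (orthant L)
  strictQuasiconcave : ∀ c ∈ posOrthant L, ∀ d ∈ posOrthant L, c ≠ d → ∀ a : ℝ, 0 < a → a < 1 →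
    min (u c) (u d) < u (a • c + (1 - a) • d)
  no_localMax : ∀ c ∈ orthant L, ¬ IsLocalMaxOn u (orthant L) c
  unbounded : ∀ M : ℝ, ∃ c ∈ orthant L, M < u c
  /-- There are no corner solutions. -/
  interior : ∀ p ∈ posOrthant L, ∀ w : ℝ, 0 < w → ∀ c, IsWalrasian u p w c → c ∈ posOrthant L
  /-- The gradient does not vanish, that is, the Lagrange multipliers of the utility maximization
  problem are positive. -/
  gradient_ne_zero : ∀ c ∈ posOrthant L, fderiv ℝ u c ≠ 0

/-- The bordered Hessian condition: on `ℝ^L_{++}` the Hessian of `u` is negative definite on the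
kernel of the differential of `u`. -/
def BorderedHessianCondition {L : ℕ} (u : (Fin L → ℝ) → ℝ) : Prop :=
  ∀ c ∈ posOrthant L, ∀ v : Fin L → ℝ, v ≠ 0 → fderiv ℝ u c v = 0 →
    fderiv ℝ (fderiv ℝ u) c v v < 0

/-- The set `ℝ^{IL}_{++}` of allocations. -/
def allocations (I L : ℕ) : Set (Fin I → Fin L → ℝ) := {y | ∀ i, y i ∈ posOrthant L}

/-- `y` Pareto dominates `z`: no household is worse off, some household is better off, and both
have the same total resources. -/
def ParetoDominates {I L : ℕ} (u : Fin I → (Fin L → ℝ) → ℝ) (y z : Fin I → Fin L → ℝ) : Prop :=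
  (∀ i, u i (z i) ≤ u i (y i)) ∧ (∃ i, u i (z i) < u i (y i)) ∧ ∑ i, y i = ∑ i, z i

/-- The set of Pareto optimal allocations. -/
def paretoSet {I L : ℕ} (u : Fin I → (Fin L → ℝ) → ℝ) : Set (Fin I → Fin L → ℝ) :=
  {y | y ∈ allocations I L ∧ ¬ ∃ z ∈ allocations I L, ParetoDominates u z y}

/-- `S` is, with the subspace topology, a topological manifold without boundary of dimension `k`
(as a subset of a normed space it is Hausdorff, and second countable in finite dimension). -/
def IsTopSubmanifold {E : Type*} [NormedAddCommGroup E] [NormedSpace ℝ E]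
    (k : ℕ) (S : Set E) : Prop :=
  Nonempty (ChartedSpace (EuclideanSpace ℝ (Fin k)) S)

/-- `S` is an embedded `C^∞` submanifold without boundary of dimension `k`: around each of its
points there is a smooth slice chart of the ambient space. -/
def IsSmoothSubmanifold {E : Type*} [NormedAddCommGroup E] [NormedSpace ℝ E]
    (k : ℕ) (S : Set E) : Prop :=
  ∀ y ∈ S, ∃ (m : ℕ) (Φ : OpenPartialHomeomorph E
      (EuclideanSpace ℝ (Fin k) × EuclideanSpace ℝ (Fin m))),
    y ∈ Φ.source ∧ ContDiffOn ℝ ∞ Φ Φ.source ∧ ContDiffOn ℝ ∞ Φ.symm Φ.target ∧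
      ∀ x ∈ Φ.source, x ∈ S ↔ (Φ x).2 = 0

open Set Filter Topology
-- Orthants, budget sets and proportional price vectors
section Orthant

variable {L : ℕ}

/-! Each consumer has natural coordinates on the open orthant: `c ↦ (mrs u c, u c)` maps bijectively
onto positive relative prices and utility levels, with inverse the Hicksian demand
(`isHicksian_iff`). This rests on the duality between the Walrasian and Hicksian problems and on the
fact that every positive bundle is demanded at its gradient prices (`isWalrasian_gradVec`).

Pareto optimality amounts to equal marginal rates of substitution (`mem_paretoSet_iff_mrs`):
otherwise a small bilateral trade improves on the allocation, while common supporting prices rule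
out domination by comparing total costs. Hence an optimum is determined by one common price vector
and `I` free utility levels, and continuity of Hicksian demand makes this parametrization a
homeomorphism from an open convex set. Wealth can replace utility as parameter because the indirect
utility of the Hicksian expenditure is the utility level.

In the smooth case the bordered Hessian condition makes these coordinates a local diffeomorphism
(`eq_zero_of_fderiv_mrs_eq_zero`). In the product coordinates of all consumers the Pareto set is the
linear subspace where the price components agree. -/

theorem posOrthant_subset_orthant : posOrthant L ⊆ orthant L := fun _ hc l => (hc l).le

theorem isOpen_posOrthant : IsOpen (posOrthant L) := by
  have h : posOrthant L = ⋂ l, {c : Fin L → ℝ | 0 < c l} := by ext; simp [posOrthant]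
  rw [h]
  exact isOpen_iInter_of_finite fun l => isOpen_lt continuous_const (continuous_apply l)

theorem isClosed_orthant : IsClosed (orthant L) := by
  have h : orthant L = ⋂ l, {c : Fin L → ℝ | 0 ≤ c l} := by ext; simp [orthant]
  rw [h]
  exact isClosed_iInter fun l => isClosed_le continuous_const (continuous_apply l)

theorem convex_posOrthant : Convex ℝ (posOrthant L) := by
  have h : posOrthant L = univ.pi fun _ => Ioi (0 : ℝ) := by ext; simp [posOrthant]
  rw [h]
  exact convex_pi fun _ _ => convex_Ioi 0

theorem nonempty_posOrthant : (posOrthant L).Nonempty := ⟨1, fun _ => one_pos⟩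

theorem continuous_dotProduct_left (p : Fin L → ℝ) : Continuous fun c : Fin L → ℝ => p ⬝ᵥ c := by
  unfold dotProduct; fun_prop

theorem smul_mem_orthant {s : ℝ} (hs : 0 ≤ s) {c : Fin L → ℝ} (hc : c ∈ orthant L) :
    s • c ∈ orthant L := fun l => mul_nonneg hs (hc l)

theorem smul_mem_posOrthant {s : ℝ} (hs : 0 < s) {c : Fin L → ℝ} (hc : c ∈ posOrthant L) :
    s • c ∈ posOrthant L := fun l => mul_pos hs (hc l)

theorem dotProduct_pos_of_posOrthant {p c : Fin L → ℝ} (hp : p ∈ posOrthant L)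
    (hc : c ∈ orthant L) (h0 : c ≠ 0) : 0 < p ⬝ᵥ c := by
  obtain ⟨l, hl⟩ := Function.ne_iff.1 h0
  exact Finset.sum_pos' (fun k _ => mul_nonneg (hp k).le (hc k))
    ⟨l, Finset.mem_univ _, mul_pos (hp l) (lt_of_le_of_ne (hc l) (Ne.symm hl))⟩

theorem isCompact_budgetSet {p : Fin L → ℝ} (hp : p ∈ posOrthant L) (w : ℝ) :
    IsCompact (budgetSet p w) := by
  refine (isCompact_Icc (a := (0 : Fin L → ℝ)) (b := fun l => w / p l)).of_isClosed_subset
    (isClosed_orthant.inter (isClosed_le (continuous_dotProduct_left p) continuous_const)) ?_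
  rintro c ⟨hc, hw⟩
  refine ⟨hc, fun l => ?_⟩
  rw [le_div_iff₀ (hp l), mul_comm]
  exact (Finset.single_le_sum (f := fun k => p k * c k)
    (fun k _ => mul_nonneg (hp k).le (hc k)) (Finset.mem_univ l)).trans hw

theorem budgetSet_smul {a : ℝ} (ha : 0 < a) (p : Fin L → ℝ) (w : ℝ) :
    budgetSet (a • p) (a * w) = budgetSet p w := by
  ext c
  simp only [budgetSet, mem_ofPred_eq, smul_dotProduct, smul_eq_mul, mul_le_mul_iff_right₀ ha]

theorem isWalrasian_smul {u : (Fin L → ℝ) → ℝ} {a : ℝ} (ha : 0 < a) {p : Fin L → ℝ} {w : ℝ}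
    {c : Fin L → ℝ} : IsWalrasian u (a • p) (a * w) c ↔ IsWalrasian u p w c := by
  rw [IsWalrasian, budgetSet_smul ha, IsWalrasian]

/-- Two positive vectors are proportional as soon as their open half-space and closed half-space
are nested. -/
theorem mul_eq_mul_of_dotProduct_nonneg {a b : Fin L → ℝ} (ha : a ∈ posOrthant L)
    (h : ∀ v, 0 < a ⬝ᵥ v → 0 ≤ b ⬝ᵥ v) (k l : Fin L) : a k * b l = a l * b k := by
  have key : ∀ k l, a k * b l ≤ a l * b k := by
    intro k l
    have hε : ∀ ε > 0, 0 ≤ a l * b k - a k * b l + ε * b k := by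
      intro ε hε
      -- The product of `a` with this test vector is `a k * ε`, so `ε` makes the hypothesis strict;
      -- it is then sent to zero.
      have := h (Pi.single k (a l + ε) - Pi.single l (a k)) (by
        simp only [dotProduct_sub, dotProduct_single]
        nlinarith [mul_pos (ha k) hε])
      simp only [dotProduct_sub, dotProduct_single] at this
      linarith
    have ht : Tendsto (fun ε : ℝ => a l * b k - a k * b l + ε * b k) (𝓝[>] 0)
        (𝓝 (a l * b k - a k * b l + 0 * b k)) :=
      (Continuous.tendsto (by fun_prop) 0).mono_left nhdsWithin_le_nhds
    have := ge_of_tendsto ht (eventually_nhdsWithin_of_forall hε)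
    linarith
  exact le_antisymm (key k l) (key l k)

end Orthant

/-! ### Walrasian and Hicksian demand: existence, uniqueness, duality, continuity -/

section Demand

variable {L : ℕ} {u : (Fin L → ℝ) → ℝ}

namespace IsUtility

theorem exists_isWalrasian (hu : IsUtility u) {p : Fin L → ℝ} (hp : p ∈ posOrthant L) {w : ℝ}
    (hw : 0 < w) : ∃ c, IsWalrasian u p w c := by
  obtain ⟨c, hc, hmax⟩ := (isCompact_budgetSet hp w).exists_isMaxOn
    ⟨0, fun _ => le_rfl, by simpa using hw.le⟩ (hu.continuousOn.mono fun _ h => h.1)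
  exact ⟨c, hc, hmax⟩

/-- The midpoint of two maximizers is affordable and strictly better. Strict quasi-concavity holds
only on the open orthant, so the absence of corner solutions is essential here. -/
theorem isWalrasian_unique (hu : IsUtility u) {p : Fin L → ℝ} (hp : p ∈ posOrthant L) {w : ℝ}
    (hw : 0 < w) {c d : Fin L → ℝ} (hc : IsWalrasian u p w c) (hd : IsWalrasian u p w d) :
    c = d := by
  by_contra hne
  have hc' := hu.interior p hp w hw c hc
  have hd' := hu.interior p hp w hw d hd
  have h := hu.strictQuasiconcave c hc' d hd' hne (1 / 2) (by norm_num) (by norm_num)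
  rw [min_eq_left (hd.2 c hc.1)] at h
  refine absurd (hc.2 _ ⟨posOrthant_subset_orthant
    (convex_posOrthant hc' hd' (by norm_num) (by norm_num) (by norm_num)), ?_⟩) h.not_ge
  have h1 := hc.1.2
  have h2 := hd.1.2
  rw [dotProduct_add, dotProduct_smul, dotProduct_smul, smul_eq_mul, smul_eq_mul]
  linarith

theorem ne_zero_of_pos (hu : IsUtility u) {c : Fin L → ℝ} (hc : 0 < u c) : c ≠ 0 := by
  rintro rfl
  exact hc.ne' hu.zero

/-- A bundle of positive utility may be made cheaper while staying above a lower utility level. -/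
theorem exists_cheaper (hu : IsUtility u) {p : Fin L → ℝ} (hp : p ∈ posOrthant L) {t : ℝ}
    (ht : 0 ≤ t) {d : Fin L → ℝ} (hd : d ∈ orthant L) (h : t < u d) :
    ∃ e ∈ orthant L, t < u e ∧ p ⬝ᵥ e < p ⬝ᵥ d := by
  -- Shrink `d` radially to `s • d` with `s` slightly below 1. The cost drops because `d ≠ 0`, which
  -- follows from `u 0 = 0`.
  have hcont : ContinuousWithinAt (fun s : ℝ => u (s • d)) (Ico 0 1) 1 := by
    refine ContinuousWithinAt.comp (t := orthant L) ?_ (by fun_prop)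
      (fun s hs => smul_mem_orthant hs.1 hd)
    simpa using hu.continuousOn d hd
  have hlim : ∀ᶠ s in 𝓝[Ico 0 1] (1 : ℝ), t < u (s • d) :=
    hcont.eventually_const_lt (by simpa using h)
  have : (𝓝[Ico 0 1] (1 : ℝ)).NeBot := by
    rw [nhdsWithin_Ico_eq_nhdsLT one_pos]; infer_instance
  obtain ⟨s, hs, hs01⟩ := (hlim.and self_mem_nhdsWithin).exists
  refine ⟨s • d, smul_mem_orthant hs01.1 hd, hs, ?_⟩
  have := dotProduct_pos_of_posOrthant hp hd (hu.ne_zero_of_pos (ht.trans_lt h))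
  rw [dotProduct_smul, smul_eq_mul]
  nlinarith [hs01.2]

theorem isWalrasian_of_isHicksian (hu : IsUtility u) {p : Fin L → ℝ} (hp : p ∈ posOrthant L)
    {t : ℝ} (ht : 0 < t) {c : Fin L → ℝ} (hc : IsHicksian u p t c) :
    IsWalrasian u p (p ⬝ᵥ c) c := by
  refine ⟨⟨hc.1.1, le_rfl⟩, fun d hd => ?_⟩
  by_contra! h
  obtain ⟨e, he, hte, hlt⟩ := hu.exists_cheaper hp ht.le hd.1 (hc.1.2.trans_lt h)
  exact (hc.2 e he hte.le).not_gt (hlt.trans_le hd.2)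

theorem expenditure_pos (hu : IsUtility u) {p : Fin L → ℝ} (hp : p ∈ posOrthant L)
    {t : ℝ} (ht : 0 < t) {c : Fin L → ℝ} (hc : IsHicksian u p t c) : 0 < p ⬝ᵥ c :=
  dotProduct_pos_of_posOrthant hp hc.1.1 (hu.ne_zero_of_pos (ht.trans_le hc.1.2))

theorem utility_eq_of_isHicksian (hu : IsUtility u) {p : Fin L → ℝ} (hp : p ∈ posOrthant L)
    {t : ℝ} (ht : 0 < t) {c : Fin L → ℝ} (hc : IsHicksian u p t c) : u c = t := by
  by_contra h
  obtain ⟨e, he, hte, hlt⟩ := hu.exists_cheaper hp ht.le hc.1.1 (lt_of_le_of_ne hc.1.2 (Ne.symm h))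
  exact (hc.2 e he hte.le).not_gt hlt

theorem isHicksian_mem_posOrthant (hu : IsUtility u) {p : Fin L → ℝ} (hp : p ∈ posOrthant L)
    {t : ℝ} (ht : 0 < t) {c : Fin L → ℝ} (hc : IsHicksian u p t c) : c ∈ posOrthant L :=
  hu.interior p hp _ (hu.expenditure_pos hp ht hc) c (hu.isWalrasian_of_isHicksian hp ht hc)

theorem isHicksian_unique (hu : IsUtility u) {p : Fin L → ℝ} (hp : p ∈ posOrthant L)
    {t : ℝ} (ht : 0 < t) {c d : Fin L → ℝ} (hc : IsHicksian u p t c) (hd : IsHicksian u p t d) :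
    c = d := by
  have h : p ⬝ᵥ c = p ⬝ᵥ d := le_antisymm (hc.2 d hd.1.1 hd.1.2) (hd.2 c hc.1.1 hc.1.2)
  refine hu.isWalrasian_unique hp (hu.expenditure_pos hp ht hc)
    (hu.isWalrasian_of_isHicksian hp ht hc) ?_
  rw [h]
  exact hu.isWalrasian_of_isHicksian hp ht hd

/-- Unboundedness supplies a feasible bundle `d`, and bundles dearer than `d` can be discarded; what
remains is compact. -/
theorem exists_isHicksian (hu : IsUtility u) {p : Fin L → ℝ} (hp : p ∈ posOrthant L) (t : ℝ) :
    ∃ c, IsHicksian u p t c := by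
  obtain ⟨d, hd, htd⟩ := hu.unbounded t
  have hclosed : IsClosed (orthant L ∩ u ⁻¹' Ici t) :=
    hu.continuousOn.preimage_isClosed_of_isClosed isClosed_orthant isClosed_Ici
  obtain ⟨c, hc, hmin⟩ := ((isCompact_budgetSet hp (p ⬝ᵥ d)).inter_right hclosed).exists_isMinOn
    ⟨d, ⟨hd, le_rfl⟩, hd, htd.le⟩ (continuous_dotProduct_left p).continuousOn
  refine ⟨c, hc.2, fun e he hte => ?_⟩
  rcases le_total (p ⬝ᵥ e) (p ⬝ᵥ d) with h | h
  · exact hmin ⟨⟨he, h⟩, he, hte⟩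
  · exact hc.1.2.trans h

/-- There is a strictly better bundle next to any given one. -/
theorem frequently_lt (hu : IsUtility u) {c : Fin L → ℝ} (hc : c ∈ orthant L) :
    ∃ᶠ d in 𝓝[orthant L] c, u c < u d := by
  have h := hu.no_localMax c hc
  simpa only [IsLocalMaxOn, IsMaxFilter, not_eventually, not_le] using h

/-- Local nonsatiation: a cheaper bundle that is at least as good would have a strictly better
neighbour that is still affordable. -/
theorem isHicksian_of_isWalrasian (hu : IsUtility u) {p : Fin L → ℝ} {w : ℝ} {c : Fin L → ℝ}
    (hc : IsWalrasian u p w c) : IsHicksian u p (u c) c := by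
  refine ⟨⟨hc.1.1, le_rfl⟩, fun d hd hcd => ?_⟩
  by_contra! h
  have hev : ∀ᶠ e in 𝓝[orthant L] d, p ⬝ᵥ e < p ⬝ᵥ c :=
    ((continuous_dotProduct_left p).continuousWithinAt).eventually_lt_const h
  obtain ⟨e, hlt, he, heo⟩ := ((hu.frequently_lt hd).and_eventually
    (hev.and self_mem_nhdsWithin)).exists
  exact (hc.2 e ⟨heo, he.le.trans hc.1.2⟩).not_gt (hcd.trans_lt hlt)

theorem utility_pos_of_isWalrasian (hu : IsUtility u) {p : Fin L → ℝ} {w : ℝ} (hw : 0 < w)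
    {c : Fin L → ℝ} (hc : IsWalrasian u p w c) : 0 < u c := by
  have h0 : (0 : Fin L → ℝ) ∈ orthant L := fun _ => le_rfl
  have hev : ∀ᶠ e in 𝓝[orthant L] (0 : Fin L → ℝ), p ⬝ᵥ e < w :=
    ((continuous_dotProduct_left p).continuousWithinAt).eventually_lt_const (by simpa using hw)
  obtain ⟨e, hlt, he, heo⟩ := ((hu.frequently_lt h0).and_eventually
    (hev.and self_mem_nhdsWithin)).exists
  rw [hu.zero] at hlt
  exact hlt.trans_le (hc.2 e ⟨heo, he.le⟩)

theorem isHicksian_hicks (hu : IsUtility u) {p : Fin L → ℝ} (hp : p ∈ posOrthant L) (t : ℝ) :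
    IsHicksian u p t (hicks u p t) := by
  have h := hu.exists_isHicksian hp t
  rw [hicks, dif_pos h]
  exact h.choose_spec

theorem isWalrasian_walras (hu : IsUtility u) {p : Fin L → ℝ} (hp : p ∈ posOrthant L) {w : ℝ}
    (hw : 0 < w) : IsWalrasian u p w (walras u p w) := by
  have h := hu.exists_isWalrasian hp hw
  rw [walras, dif_pos h]
  exact h.choose_spec

/-- Budget sets are invariant under joint scaling of prices and wealth, so wealth can be normalized
to 1. -/
theorem isWalrasian_normWalras (hu : IsUtility u) {p : Fin L → ℝ} (hp : p ∈ posOrthant L) {w : ℝ}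
    (hw : 0 < w) : IsWalrasian u p w (normWalras u (w⁻¹ • p)) := by
  rw [← isWalrasian_smul (inv_pos.2 hw), inv_mul_cancel₀ hw.ne']
  exact hu.isWalrasian_walras (smul_mem_posOrthant (inv_pos.2 hw) hp) one_pos

theorem normIndirect_pos (hu : IsUtility u) {p : Fin L → ℝ} (hp : p ∈ posOrthant L) {w : ℝ}
    (hw : 0 < w) : 0 < normIndirect u (w⁻¹ • p) :=
  hu.utility_pos_of_isWalrasian hw (hu.isWalrasian_normWalras hp hw)

/-- The indirect utility of the expenditure of the Hicksian demand is the utility level. -/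
theorem normIndirect_expenditure (hu : IsUtility u) {p : Fin L → ℝ} (hp : p ∈ posOrthant L)
    {t : ℝ} (ht : 0 < t) : normIndirect u ((p ⬝ᵥ hicks u p t)⁻¹ • p) = t := by
  have hh := hu.isHicksian_hicks hp t
  have hw := hu.expenditure_pos hp ht hh
  rw [normIndirect, hu.isWalrasian_unique hp hw (hu.isWalrasian_normWalras hp hw)
    (hu.isWalrasian_of_isHicksian hp ht hh), hu.utility_eq_of_isHicksian hp ht hh]

/-- The Hicksian demand depends continuously on prices and utility level. -/
theorem continuousOn_hicks (hu : IsUtility u) :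
    ContinuousOn (fun x : (Fin L → ℝ) × ℝ => hicks u x.1 x.2) (posOrthant L ×ˢ Ioi 0) := by
  rintro ⟨p, t⟩ ⟨hp : p ∈ posOrthant L, ht : 0 < t⟩
  obtain ⟨d, hd, htd⟩ := hu.unbounded t
  -- Prices near `p` exceed `p / 2`, so all nearby Hicksian demands lie in one compact budget set at
  -- the halved prices. It then suffices that every cluster point solves the limit problem, which
  -- has a unique solution.
  have hp2 : (2⁻¹ : ℝ) • p ∈ posOrthant L := smul_mem_posOrthant (by norm_num) hp
  have hmem : ∀ᶠ x in 𝓝[posOrthant L ×ˢ Ioi 0] (p, t), x ∈ posOrthant L ×ˢ Ioi (0 : ℝ) :=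
    self_mem_nhdsWithin
  have hdot : Continuous fun x : ((Fin L → ℝ) × ℝ) × (Fin L → ℝ) => x.1.1 ⬝ᵥ x.2 := by
    unfold dotProduct; fun_prop
  refine (isCompact_budgetSet hp2 (p ⬝ᵥ d + 1)).tendsto_nhds_of_unique_mapClusterPt ?_ ?_
  · have h1 : ∀ᶠ x in 𝓝 (p, t), ∀ l, 2⁻¹ * p l < x.1 l := by
      refine eventually_all.2 fun l => ?_
      exact ((by fun_prop : Continuous fun x : (Fin L → ℝ) × ℝ => x.1 l).tendsto
        (p, t)).eventually_const_lt (by have := hp l; simp only; linarith)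
    have h2 : ∀ᶠ x in 𝓝 (p, t), x.2 < u d :=
      (continuous_snd.tendsto (p, t)).eventually_lt_const htd
    have h3 : ∀ᶠ x in 𝓝 (p, t), x.1 ⬝ᵥ d < p ⬝ᵥ d + 1 :=
      ((hdot.comp (Continuous.prodMk_left d)).tendsto (p, t)).eventually_lt_const (by simp)
    filter_upwards [hmem, nhdsWithin_le_nhds h1, nhdsWithin_le_nhds h2, nhdsWithin_le_nhds h3]
      with x hx hx1 hx2 hx3
    have hh := hu.isHicksian_hicks hx.1 x.2
    refine ⟨hh.1.1, ?_⟩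
    calc ((2⁻¹ : ℝ) • p) ⬝ᵥ hicks u x.1 x.2 ≤ x.1 ⬝ᵥ hicks u x.1 x.2 :=
          Finset.sum_le_sum fun l _ => mul_le_mul_of_nonneg_right (hx1 l).le (hh.1.1 l)
      _ ≤ x.1 ⬝ᵥ d := hh.2 d hd hx2.le
      _ ≤ _ := hx3.le
  · intro y hy hcl
    obtain ⟨U, hU, hlim⟩ := mapClusterPt_iff_ultrafilter.1 hcl
    have hUn : Tendsto id (U : Filter ((Fin L → ℝ) × ℝ)) (𝓝 (p, t)) := hU.trans nhdsWithin_le_nhds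
    have hUmem := hU hmem
    have huy : t = u y := by
      have hl : Tendsto (fun x : (Fin L → ℝ) × ℝ => hicks u x.1 x.2) U (𝓝[orthant L] y) := by
        refine tendsto_nhdsWithin_iff.2 ⟨hlim, ?_⟩
        filter_upwards [hUmem] with x hx using (hu.isHicksian_hicks hx.1 x.2).1.1
      refine tendsto_nhds_unique ((continuous_snd.tendsto _).comp hUn)
        (((hu.continuousOn y hy.1).tendsto.comp hl).congr' ?_)
      filter_upwards [hUmem] with x hx
      exact hu.utility_eq_of_isHicksian hx.1 hx.2 (hu.isHicksian_hicks hx.1 x.2)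
    -- The strict inequality keeps `e` feasible for all nearby utility levels; the case `t = u e` is
    -- recovered below from local nonsatiation.
    have hle : ∀ e ∈ orthant L, t < u e → p ⬝ᵥ y ≤ p ⬝ᵥ e := by
      intro e he hte
      have hl1 := (hdot.tendsto ((p, t), y)).comp (hUn.prodMk_nhds hlim)
      have hl2 := (hdot.tendsto ((p, t), e)).comp (hUn.prodMk_nhds tendsto_const_nhds)
      refine le_of_tendsto_of_tendsto hl1 hl2 ?_
      have hlt : ∀ᶠ x in (U : Filter ((Fin L → ℝ) × ℝ)), x.2 < u e :=
        ((continuous_snd.tendsto (p, t)).comp hUn).eventually_lt_const hte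
      filter_upwards [hUmem, hlt] with x hx hxe
      exact (hu.isHicksian_hicks hx.1 x.2).2 e he hxe.le
    refine hu.isHicksian_unique hp ht ⟨⟨hy.1, huy.le⟩, fun e he hte => ?_⟩
      (hu.isHicksian_hicks hp t)
    by_contra! h
    have hev : ∀ᶠ e' in 𝓝[orthant L] e, p ⬝ᵥ e' < p ⬝ᵥ y :=
      ((continuous_dotProduct_left p).continuousWithinAt).eventually_lt_const h
    obtain ⟨e', hlt, he', heo⟩ := ((hu.frequently_lt he).and_eventually
      (hev.and self_mem_nhdsWithin)).exists
    exact (hle e' heo (hte.trans_lt hlt)).not_gt he'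

end IsUtility

end Demand

/-! ### Gradients as supporting prices -/

section Gradient

variable {L : ℕ} {u : (Fin L → ℝ) → ℝ}

/-- The gradient of `u` at `c`, in coordinates. -/
noncomputable def gradVec (u : (Fin L → ℝ) → ℝ) (c : Fin L → ℝ) : Fin L → ℝ :=
  fun l => fderiv ℝ u c (Pi.single l 1)

theorem map_eq_sum_single {F : Type*} [AddCommMonoid F] [Module ℝ F] [TopologicalSpace F]
    (D : (Fin L → ℝ) →L[ℝ] F) (v : Fin L → ℝ) : D v = ∑ l, v l • D (Pi.single l 1) := by
  conv_lhs => rw [pi_eq_sum_univ' v, map_sum]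
  simp

theorem gradVec_dotProduct (u : (Fin L → ℝ) → ℝ) (c v : Fin L → ℝ) :
    gradVec u c ⬝ᵥ v = fderiv ℝ u c v := by
  rw [map_eq_sum_single (fderiv ℝ u c) v]
  exact Finset.sum_congr rfl fun l _ => mul_comm _ _

namespace IsUtility

theorem contDiffAt (hu : IsUtility u) {c : Fin L → ℝ} (hc : c ∈ posOrthant L) :
    ContDiffAt ℝ ∞ u c :=
  hu.smooth.contDiffAt (isOpen_posOrthant.mem_nhds hc)

theorem hasFDerivAt (hu : IsUtility u) {c : Fin L → ℝ} (hc : c ∈ posOrthant L) :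
    HasFDerivAt u (fderiv ℝ u c) c :=
  ((hu.contDiffAt hc).differentiableAt (by simp)).hasFDerivAt

theorem contDiffOn_fderiv (hu : IsUtility u) : ContDiffOn ℝ ∞ (fderiv ℝ u) (posOrthant L) :=
  ((contDiffOn_infty_iff_fderiv_of_isOpen isOpen_posOrthant).1 hu.smooth).2

theorem eventually_lt_add_smul (hu : IsUtility u) {c : Fin L → ℝ} (hc : c ∈ posOrthant L)
    {v : Fin L → ℝ} (hv : 0 < fderiv ℝ u c v) :
    ∀ᶠ s in 𝓝[>] (0 : ℝ), c + s • v ∈ posOrthant L ∧ u c < u (c + s • v) := by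
  have hline : HasDerivAt (fun s : ℝ => c + s • v) v 0 := by
    simpa using ((hasDerivAt_id (0 : ℝ)).smul_const v).const_add c
  have hd : HasDerivAt (fun s : ℝ => u (c + s • v)) (fderiv ℝ u c v) 0 :=
    HasFDerivAt.comp_hasDerivAt 0 (by simpa using hu.hasFDerivAt hc) hline
  have h1 : ∀ᶠ s in 𝓝 (0 : ℝ), c + s • v ∈ posOrthant L :=
    hline.continuousAt.eventually_mem (by simpa using isOpen_posOrthant.mem_nhds hc)
  have h2 := (hasDerivWithinAt_iff_tendsto_slope' (s := Ioi (0 : ℝ)) (by simp)).1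
    (hd.hasDerivWithinAt)
  filter_upwards [nhdsWithin_le_nhds h1, h2.eventually_const_lt hv, self_mem_nhdsWithin]
    with s hs1 hs2 hs3
  refine ⟨hs1, ?_⟩
  rw [slope_def_field] at hs2
  have := (div_pos_iff_of_pos_right (by simpa using hs3)).1 hs2
  simpa using this

/-- The midpoint is strictly better than `c` by quasi-concavity and no better than `d` by
monotonicity. -/
theorem lt_of_le_of_ne (hu : IsUtility u) {c d : Fin L → ℝ} (hc : c ∈ posOrthant L)
    (hd : d ∈ posOrthant L) (hle : c ≤ d) (hne : c ≠ d) : u c < u d := by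
  have hcd : u c ≤ u d := hu.monotone (posOrthant_subset_orthant hc)
    (posOrthant_subset_orthant hd) hle
  have h := hu.strictQuasiconcave c hc d hd hne (1 / 2) (by norm_num) (by norm_num)
  rw [min_eq_left hcd] at h
  refine h.trans_le (hu.monotone (posOrthant_subset_orthant
    (convex_posOrthant hc hd (by norm_num) (by norm_num) (by norm_num)))
    (posOrthant_subset_orthant hd) fun l => ?_)
  have := hle l
  simp only [Pi.add_apply, Pi.smul_apply, smul_eq_mul]
  linarith

/-- Quasi-concavity gives only a nonnegative derivative towards any better bundle. Since the
gradient is nonzero, `d` can be moved slightly along a direction of negative derivative and stay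
better than `c`, which excludes the value zero. -/
theorem fderiv_sub_pos (hu : IsUtility u) {c d : Fin L → ℝ} (hc : c ∈ posOrthant L)
    (hd : d ∈ posOrthant L) (h : u c < u d) : 0 < fderiv ℝ u c (d - c) := by
  have hweak : ∀ e ∈ posOrthant L, u c < u e → 0 ≤ fderiv ℝ u c (e - c) := by
    intro e he hce
    by_contra! hneg
    have hline : HasDerivAt (fun s : ℝ => c + s • (e - c)) (e - c) 0 := by
      simpa using ((hasDerivAt_id (0 : ℝ)).smul_const (e - c)).const_add c
    have hd : HasDerivAt (fun s : ℝ => u (c + s • (e - c))) (fderiv ℝ u c (e - c)) 0 :=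
      HasFDerivAt.comp_hasDerivAt 0 (by simpa using hu.hasFDerivAt hc) hline
    have h2 := (hasDerivWithinAt_iff_tendsto_slope' (s := Ioi (0 : ℝ)) (by simp)).1
      (hd.hasDerivWithinAt)
    have h1 : ∀ᶠ s in 𝓝[>] (0 : ℝ), s < 1 := nhdsWithin_le_nhds (eventually_lt_nhds one_pos)
    obtain ⟨s, hs1, hs2, hs3 : 0 < s⟩ :=
      (h1.and ((h2.eventually_lt_const hneg).and self_mem_nhdsWithin)).exists
    rw [slope_def_field, div_neg_iff] at hs2
    have hq := hu.strictQuasiconcave c hc e he (fun hEq => hce.ne (by rw [hEq])) (1 - s)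
      (by linarith) (by linarith)
    rw [min_eq_left hce.le] at hq
    have hEq : (1 - s) • c + (1 - (1 - s)) • e = c + s • (e - c) := by
      ext l; simp only [Pi.add_apply, Pi.smul_apply, Pi.sub_apply, smul_eq_mul]; ring
    rw [hEq] at hq
    simp only [sub_zero, zero_smul, add_zero] at hs2
    rcases hs2 with hs2 | hs2 <;> linarith
  obtain ⟨v, hv⟩ : ∃ v, fderiv ℝ u c v < 0 := by
    obtain ⟨v, hv⟩ : ∃ v, fderiv ℝ u c v ≠ 0 := by
      by_contra! h0
      exact hu.gradient_ne_zero c hc (ContinuousLinearMap.ext h0)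
    rcases lt_or_gt_of_ne hv with hv | hv
    · exact ⟨v, hv⟩
    · exact ⟨-v, by simpa using hv⟩
  have hline : ContinuousAt (fun s : ℝ => d + s • v) 0 := by fun_prop
  have h1 : ∀ᶠ s in 𝓝 (0 : ℝ), d + s • v ∈ posOrthant L :=
    hline.eventually_mem (by simpa using isOpen_posOrthant.mem_nhds hd)
  have h2 : ∀ᶠ s in 𝓝 (0 : ℝ), u c < u (d + s • v) := by
    have hcont : ContinuousAt (fun s : ℝ => u (d + s • v)) 0 :=
      ContinuousAt.comp (by simpa using (hu.hasFDerivAt hd).continuousAt) hline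
    exact hcont.tendsto.eventually_const_lt (by simpa using h)
  obtain ⟨s, hs, hs0 : 0 < s⟩ := ((h1.and h2).filter_mono nhdsWithin_le_nhds |>.and
    (self_mem_nhdsWithin : ∀ᶠ s in 𝓝[>] (0 : ℝ), s ∈ Ioi (0 : ℝ))).exists
  have := hweak _ hs.1 hs.2
  rw [add_sub_right_comm, map_add, map_smul, smul_eq_mul] at this
  nlinarith

theorem gradVec_mem_posOrthant (hu : IsUtility u) {c : Fin L → ℝ} (hc : c ∈ posOrthant L) :
    gradVec u c ∈ posOrthant L := by
  intro l
  have h0 : (0 : Fin L → ℝ) ≤ Pi.single l (1 : ℝ) := by simp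
  have hd : c + Pi.single l (1 : ℝ) ∈ posOrthant L := fun k =>
    add_pos_of_pos_of_nonneg (hc k) (h0 k)
  have := hu.fderiv_sub_pos hc hd (hu.lt_of_le_of_ne hc hd (le_add_of_nonneg_right h0) (by simp))
  simpa [gradVec] using this

/-- Every positive bundle is demanded at the prices given by the gradient. -/
theorem isWalrasian_gradVec (hu : IsUtility u) {c : Fin L → ℝ} (hc : c ∈ posOrthant L) :
    IsWalrasian u (gradVec u c) (gradVec u c ⬝ᵥ c) c := by
  refine ⟨⟨posOrthant_subset_orthant hc, le_rfl⟩, fun d ⟨hd, hle⟩ => ?_⟩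
  by_contra! h
  -- The bundle `d` may lie on the boundary, where `fderiv_sub_pos` does not apply; pulling it
  -- slightly towards `c` makes it positive and keeps it better.
  have hmem : ∀ s ∈ Ioc (0 : ℝ) 1, d + s • (c - d) ∈ posOrthant L := by
    intro s hs l
    have h1 := mul_pos hs.1 (hc l)
    have h2 := mul_nonneg (sub_nonneg.2 hs.2) (hd l)
    simp only [Pi.add_apply, Pi.smul_apply, Pi.sub_apply, smul_eq_mul]
    linarith
  have hcont : ContinuousWithinAt (fun s : ℝ => u (d + s • (c - d))) (Ioc 0 1) 0 := by
    refine ContinuousWithinAt.comp (t := orthant L) ?_ (by fun_prop)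
      (fun s hs => posOrthant_subset_orthant (hmem s hs))
    simpa using hu.continuousOn d hd
  have hlim : ∀ᶠ s in 𝓝[Ioc 0 1] (0 : ℝ), u c < u (d + s • (c - d)) :=
    hcont.eventually_const_lt (by simpa using h)
  have : (𝓝[Ioc 0 1] (0 : ℝ)).NeBot := by
    rw [nhdsWithin_Ioc_eq_nhdsGT one_pos]; infer_instance
  obtain ⟨s, hs, hs01⟩ := (hlim.and self_mem_nhdsWithin).exists
  have hpos := hu.fderiv_sub_pos hc (hmem s hs01) hs
  have hEq : d + s • (c - d) - c = (1 - s) • (d - c) := by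
    ext l; simp only [Pi.add_apply, Pi.smul_apply, Pi.sub_apply, smul_eq_mul]; ring
  rw [hEq, map_smul, map_sub, ← gradVec_dotProduct, ← gradVec_dotProduct, smul_eq_mul] at hpos
  nlinarith [hs01.2]

/-- The first order conditions: the gradient at a demanded bundle is proportional to prices. -/
theorem gradVec_mul_eq_mul (hu : IsUtility u) {p : Fin L → ℝ} {w : ℝ}
    {c : Fin L → ℝ} (hcpos : c ∈ posOrthant L) (hc : IsWalrasian u p w c) (k l : Fin L) :
    gradVec u c k * p l = gradVec u c l * p k := by
  refine mul_eq_mul_of_dotProduct_nonneg (hu.gradVec_mem_posOrthant hcpos) (fun v hv => ?_) k l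
  rw [gradVec_dotProduct] at hv
  by_contra! hneg
  obtain ⟨s, hs, hs0 : 0 < s⟩ :=
    ((hu.eventually_lt_add_smul hcpos hv).and self_mem_nhdsWithin).exists
  refine (hc.2 _ ⟨posOrthant_subset_orthant hs.1, ?_⟩).not_gt hs.2
  have := hc.1.2
  rw [dotProduct_add, dotProduct_smul, smul_eq_mul]
  nlinarith

theorem contDiffOn_gradVec (hu : IsUtility u) (l : Fin L) :
    ContDiffOn ℝ ∞ (fun c => gradVec u c l) (posOrthant L) :=
  hu.contDiffOn_fderiv.clm_apply contDiffOn_const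

end IsUtility

theorem withNumeraire_castLE (q : Fin (L - 1) → ℝ) (l : Fin (L - 1)) :
    withNumeraire (L := L) q (Fin.castLE (Nat.sub_le L 1) l) = q l := by
  simp [withNumeraire]

theorem withNumeraire_mem_posOrthant {q : Fin (L - 1) → ℝ} (hq : q ∈ posOrthant (L - 1)) :
    withNumeraire (L := L) q ∈ posOrthant L := by
  intro l
  unfold withNumeraire
  split_ifs
  exacts [hq _, one_pos]

theorem continuous_withNumeraire : Continuous (withNumeraire (L := L)) := by
  refine continuous_pi fun l => ?_
  unfold withNumeraire
  split_ifs
  exacts [continuous_apply _, continuous_const]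

end Gradient

/-! ### Marginal rates of substitution and utility as coordinates -/

section Mrs

variable {L : ℕ} [NeZero L] {u : (Fin L → ℝ) → ℝ}

/-- The index of the numeraire good. -/
def numeraire (L : ℕ) [NeZero L] : Fin L := ⟨L - 1, Nat.sub_lt (NeZero.pos L) one_pos⟩

/-- The marginal rates of substitution, that is, the gradient prices of the goods in terms of the
numeraire. -/
noncomputable def mrs (u : (Fin L → ℝ) → ℝ) (c : Fin L → ℝ) : Fin (L - 1) → ℝ :=
  fun l => gradVec u c (Fin.castLE (Nat.sub_le L 1) l) / gradVec u c (numeraire L)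

theorem withNumeraire_numeraire (q : Fin (L - 1) → ℝ) :
    withNumeraire q (numeraire L) = 1 := by
  simp [withNumeraire, numeraire]

theorem eq_castLE_or_eq_numeraire (k : Fin L) :
    (∃ l, k = Fin.castLE (Nat.sub_le L 1) l) ∨ k = numeraire L := by
  by_cases h : k.val < L - 1
  · exact .inl ⟨⟨k, h⟩, rfl⟩
  · exact .inr (Fin.ext (by simp only [numeraire]; omega))

namespace IsUtility

theorem withNumeraire_mrs_mul (hu : IsUtility u) {c : Fin L → ℝ} (hc : c ∈ posOrthant L)
    (k : Fin L) : withNumeraire (mrs u c) k * gradVec u c (numeraire L) = gradVec u c k := by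
  have hpos := hu.gradVec_mem_posOrthant hc (numeraire L)
  obtain ⟨l, rfl⟩ | rfl := eq_castLE_or_eq_numeraire k
  · rw [withNumeraire_castLE, mrs, div_mul_cancel₀ _ hpos.ne']
  · rw [withNumeraire_numeraire, one_mul]

theorem mrs_mem_posOrthant (hu : IsUtility u) {c : Fin L → ℝ} (hc : c ∈ posOrthant L) :
    mrs u c ∈ posOrthant (L - 1) := fun _ =>
  div_pos (hu.gradVec_mem_posOrthant hc _) (hu.gradVec_mem_posOrthant hc _)

theorem isWalrasian_mrs (hu : IsUtility u) {c : Fin L → ℝ} (hc : c ∈ posOrthant L) :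
    IsWalrasian u (withNumeraire (mrs u c)) (withNumeraire (mrs u c) ⬝ᵥ c) c := by
  have hpos := hu.gradVec_mem_posOrthant hc (numeraire L)
  have hEq : gradVec u c (numeraire L) • withNumeraire (mrs u c) = gradVec u c := by
    ext k
    rw [Pi.smul_apply, smul_eq_mul, mul_comm, hu.withNumeraire_mrs_mul hc]
  rw [← isWalrasian_smul hpos, ← smul_eq_mul (_ : ℝ), ← smul_dotProduct, hEq]
  exact hu.isWalrasian_gradVec hc

theorem utility_pos (hu : IsUtility u) {c : Fin L → ℝ} (hc : c ∈ posOrthant L) : 0 < u c := by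
  refine hu.utility_pos_of_isWalrasian ?_ (hu.isWalrasian_mrs hc)
  refine dotProduct_pos_of_posOrthant (withNumeraire_mem_posOrthant (hu.mrs_mem_posOrthant hc))
    (posOrthant_subset_orthant hc) fun h => ?_
  exact (hc (numeraire L)).ne' (congrFun h _)

/-- Hicksian demand is the inverse of the map given by the marginal rates of substitution and the
utility level. -/
theorem isHicksian_iff (hu : IsUtility u) {q : Fin (L - 1) → ℝ} (hq : q ∈ posOrthant (L - 1))
    {t : ℝ} (ht : 0 < t) {c : Fin L → ℝ} :
    IsHicksian u (withNumeraire q) t c ↔ c ∈ posOrthant L ∧ mrs u c = q ∧ u c = t := by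
  have hp := withNumeraire_mem_posOrthant (L := L) hq
  constructor
  · intro h
    have hc := hu.isHicksian_mem_posOrthant hp ht h
    refine ⟨hc, funext fun l => ?_, hu.utility_eq_of_isHicksian hp ht h⟩
    have := hu.gradVec_mul_eq_mul hc (hu.isWalrasian_of_isHicksian hp ht h)
      (Fin.castLE (Nat.sub_le L 1) l) (numeraire L)
    rw [withNumeraire_castLE, withNumeraire_numeraire, mul_one] at this
    rw [mrs, this, mul_div_cancel_left₀ _ (hu.gradVec_mem_posOrthant hc _).ne']
  · rintro ⟨hc, rfl, rfl⟩
    exact hu.isHicksian_of_isWalrasian (hu.isWalrasian_mrs hc)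

theorem eq_hicks_iff (hu : IsUtility u) {q : Fin (L - 1) → ℝ} (hq : q ∈ posOrthant (L - 1))
    {t : ℝ} (ht : 0 < t) {c : Fin L → ℝ} :
    c = hicks u (withNumeraire q) t ↔ c ∈ posOrthant L ∧ mrs u c = q ∧ u c = t := by
  have hp := withNumeraire_mem_posOrthant (L := L) hq
  rw [← hu.isHicksian_iff hq ht]
  constructor
  · rintro rfl
    exact hu.isHicksian_hicks hp t
  · exact fun h => hu.isHicksian_unique hp ht h (hu.isHicksian_hicks hp t)

theorem contDiffOn_mrs (hu : IsUtility u) : ContDiffOn ℝ ∞ (mrs u) (posOrthant L) :=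
  contDiffOn_pi.2 fun _ => (hu.contDiffOn_gradVec _).div (hu.contDiffOn_gradVec _)
    fun _ hc => (hu.gradVec_mem_posOrthant hc _).ne'

/-- Under the bordered Hessian condition the differentials of the marginal rates of substitution
and of utility have no common kernel. -/
theorem eq_zero_of_fderiv_mrs_eq_zero (hu : IsUtility u) (hB : BorderedHessianCondition u)
    {c : Fin L → ℝ} (hc : c ∈ posOrthant L) {v : Fin L → ℝ} (hm : fderiv ℝ (mrs u) c v = 0)
    (hv : fderiv ℝ u c v = 0) : v = 0 := by
  by_contra hne
  have hnhds := isOpen_posOrthant.mem_nhds hc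
  have hD : HasFDerivAt (fderiv ℝ u) (fderiv ℝ (fderiv ℝ u) c) c :=
    ((hu.contDiffOn_fderiv.contDiffAt hnhds).differentiableAt (by simp)).hasFDerivAt
  have hgrad : ∀ k, HasFDerivAt (fun c => gradVec u c k)
      ((fderiv ℝ (fderiv ℝ u) c).flip (Pi.single k 1)) c := fun k => by
    simpa [gradVec] using hD.clm_apply (hasFDerivAt_const (Pi.single k (1 : ℝ)) c)
  have hmrs : HasFDerivAt (mrs u) (fderiv ℝ (mrs u) c) c :=
    ((hu.contDiffOn_mrs.contDiffAt hnhds).differentiableAt (by simp)).hasFDerivAt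
  -- With the marginal rates `m` constant to first order along `v`, differentiating the identity
  -- `∂ₖu = mₖ · ∂ₙu` (`n` the numeraire) leaves only the derivative of `∂ₙu`.
  have hkey : ∀ k, fderiv ℝ (fderiv ℝ u) c v (Pi.single k 1) =
      withNumeraire (mrs u c) k * fderiv ℝ (fderiv ℝ u) c v (Pi.single (numeraire L) 1) := by
    intro k
    obtain ⟨l, rfl⟩ | rfl := eq_castLE_or_eq_numeraire k
    · have h1 := ((hasFDerivAt_pi'.1 hmrs l).mul (hgrad (numeraire L))).congr_of_eventuallyEq
        (f₁ := fun c => gradVec u c (Fin.castLE (Nat.sub_le L 1) l)) (by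
          filter_upwards [hnhds] with d hd
          rw [← hu.withNumeraire_mrs_mul hd, withNumeraire_castLE]; rfl)
      have h2 := congrArg (fun D => D v) (h1.unique (hgrad _))
      simp [hm] at h2
      rw [withNumeraire_castLE, ← h2]
    · rw [withNumeraire_numeraire, one_mul]
  have hpos := hu.gradVec_mem_posOrthant hc (numeraire L)
  -- By `hkey`, the Hessian form at `v`, scaled by `∂ₙu`, has `fderiv ℝ u c v = 0` as a factor.
  have hzero : gradVec u c (numeraire L) * fderiv ℝ (fderiv ℝ u) c v v = 0 := by
    have hsum : fderiv ℝ u c v = ∑ k, v k * gradVec u c k := by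
      rw [map_eq_sum_single (fderiv ℝ u c) v]; rfl
    calc gradVec u c (numeraire L) * fderiv ℝ (fderiv ℝ u) c v v
        = (∑ k, v k * gradVec u c k) *
            fderiv ℝ (fderiv ℝ u) c v (Pi.single (numeraire L) 1) := by
          rw [map_eq_sum_single (fderiv ℝ (fderiv ℝ u) c v) v, Finset.mul_sum, Finset.sum_mul]
          refine Finset.sum_congr rfl fun k _ => ?_
          rw [hkey k, ← hu.withNumeraire_mrs_mul hc k, smul_eq_mul]
          ring
      _ = 0 := by rw [← hsum, hv, zero_mul]
  have := hB c hc v hne hv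
  nlinarith

end IsUtility

end Mrs

/-! ### Linear coordinates for the charts -/

section Coordinates

theorem finrank_coord (L I : ℕ) [NeZero L] : Module.finrank ℝ ((Fin (L - 1) → ℝ) × (Fin I → ℝ)) = L + I - 1 := by
  have := NeZero.pos L
  rw [Module.finrank_prod, Module.finrank_fin_fun, Module.finrank_fin_fun]
  omega

/-- A linear chart of the space of prices and utility levels. -/
noncomputable def coordEquiv (L I : ℕ) [NeZero L] [NeZero I] :
    ((Fin (L - 1) → ℝ) × (Fin I → ℝ)) ≃L[ℝ] EuclideanSpace ℝ (Fin (L + I - 1)) :=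
  ContinuousLinearEquiv.ofFinrankEq (by rw [finrank_coord, finrank_euclideanSpace_fin])

/-- The linear change of coordinates which splits the marginal rates of substitution and utility
levels into the coordinates along the Pareto set and the deviations from it. -/
def splitMap (L I : ℕ) [NeZero I] : (Fin I → (Fin (L - 1) → ℝ) × ℝ) →ₗ[ℝ]
    ((Fin (L - 1) → ℝ) × (Fin I → ℝ)) × ({i : Fin I // i ≠ 0} → Fin (L - 1) → ℝ) where
  toFun x := (((x 0).1, fun i => (x i).2), fun i => (x i).1 - (x 0).1)
  map_add' x y := by
    refine Prod.ext rfl (funext fun i => ?_)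
    exact add_sub_add_comm _ _ _ _
  map_smul' a x := by
    refine Prod.ext rfl (funext fun i => ?_)
    simp only [Pi.smul_apply, Prod.smul_fst, RingHom.id_apply, Prod.smul_snd, smul_sub]

theorem splitMap_injective (L I : ℕ) [NeZero I] : Function.Injective (splitMap L I) := by
  intro x y h
  have h0 : (x 0).1 = (y 0).1 := congrArg (fun z => z.1.1) h
  ext1 i
  refine Prod.ext ?_ (congrFun (congrArg (fun z => z.1.2) h) i)
  by_cases hi : i = 0
  · rw [hi, h0]
  · have : (x i).1 - (x 0).1 = (y i).1 - (y 0).1 :=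
      congrFun (congrArg (fun z => z.2) h) ⟨i, hi⟩
    rwa [h0, sub_left_inj] at this

end Coordinates

/-! ### Pareto optimality, supporting prices and the topological structure -/

section Pareto

variable {I L : ℕ} {u : Fin I → (Fin L → ℝ) → ℝ}

theorem isOpen_allocations : IsOpen (allocations I L) := by
  have h : allocations I L = univ.pi fun _ => posOrthant L := by ext; simp [allocations]
  rw [h]
  exact isOpen_set_pi finite_univ fun _ _ => isOpen_posOrthant

/-- At a Pareto optimal allocation the gradients of any two households are proportional. -/
theorem gradVec_mul_eq_mul_of_mem_paretoSet (hu : ∀ i, IsUtility (u i)) {y : Fin I → Fin L → ℝ}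
    (hy : y ∈ paretoSet u) {i j : Fin I} (hij : i ≠ j) (k l : Fin L) :
    gradVec (u i) (y i) k * gradVec (u j) (y j) l =
      gradVec (u i) (y i) l * gradVec (u j) (y j) k := by
  refine mul_eq_mul_of_dotProduct_nonneg ((hu i).gradVec_mem_posOrthant (hy.1 i))
    (fun v hv => ?_) k l
  rw [gradVec_dotProduct] at hv ⊢
  by_contra! hneg
  obtain ⟨s, hsi, hsj⟩ := (((hu i).eventually_lt_add_smul (hy.1 i) hv).and
    ((hu j).eventually_lt_add_smul (hy.1 j) (v := -v) (by simpa using hneg))).exists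
  -- Household `j` hands the bundle `s • v` to household `i`: both gain, and total resources are
  -- unchanged.
  set z : Fin I → Fin L → ℝ := y + (Pi.single i (s • v) - Pi.single j (s • v)) with hz
  have hzi : z i = y i + s • v := by simp [hz, hij]
  have hzj : z j = y j + s • -v := by simp [hz, hij.symm]
  have hzk : ∀ k, k ≠ i → k ≠ j → z k = y k := by
    intro k hki hkj
    simp [hz, hki, hkj]
  have hall : ∀ k, z k ∈ posOrthant L ∧ u k (y k) ≤ u k (z k) := by
    intro k
    by_cases hki : k = i
    · subst hki; rw [hzi]; exact ⟨hsi.1, hsi.2.le⟩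
    by_cases hkj : k = j
    · subst hkj; rw [hzj]; exact ⟨hsj.1, hsj.2.le⟩
    rw [hzk k hki hkj]
    exact ⟨hy.1 k, le_rfl⟩
  refine hy.2 ⟨z, fun k => (hall k).1, fun k => (hall k).2, ⟨i, by rw [hzi]; exact hsi.2⟩, ?_⟩
  simp [hz, Finset.sum_add_distrib]

/-- The parametrization of the Pareto set by prices and utility levels. -/
noncomputable def paretoParam (u : Fin I → (Fin L → ℝ) → ℝ)
    (x : (Fin (L - 1) → ℝ) × (Fin I → ℝ)) : Fin I → Fin L → ℝ :=
  fun i => hicks (u i) (withNumeraire x.1) (x.2 i)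

theorem continuousOn_paretoParam (hu : ∀ i, IsUtility (u i)) :
    ContinuousOn (paretoParam u) (posOrthant (L - 1) ×ˢ posOrthant I) := by
  refine continuousOn_pi.2 fun i => ?_
  refine (hu i).continuousOn_hicks.comp (f := fun x : (Fin (L - 1) → ℝ) × (Fin I → ℝ) =>
    (withNumeraire (L := L) x.1, x.2 i)) ?_ ?_
  · exact ((continuous_withNumeraire.comp continuous_fst).prodMk (by fun_prop)).continuousOn
  · exact fun x hx => ⟨withNumeraire_mem_posOrthant hx.1, hx.2 i⟩

variable [NeZero L]

/-- Pareto optimality means equality of the marginal rates of substitution of all households. -/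
theorem mem_paretoSet_iff_mrs (hu : ∀ i, IsUtility (u i)) {y : Fin I → Fin L → ℝ} :
    y ∈ paretoSet u ↔ y ∈ allocations I L ∧ ∀ i j, mrs (u i) (y i) = mrs (u j) (y j) := by
  constructor
  · refine fun hy => ⟨hy.1, fun i j => ?_⟩
    obtain rfl | hij := eq_or_ne i j
    · rfl
    ext l
    have hi := (hu i).gradVec_mem_posOrthant (hy.1 i) (numeraire L)
    have hj := (hu j).gradVec_mem_posOrthant (hy.1 j) (numeraire L)
    rw [mrs, mrs, div_eq_div_iff hi.ne' hj.ne', mul_comm (gradVec (u j) _ _)]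
    exact gradVec_mul_eq_mul_of_mem_paretoSet hu hy hij _ _
  · rintro ⟨hy, heq⟩
    refine ⟨hy, ?_⟩
    rintro ⟨z, hz, hle, ⟨j, hj⟩, hsum⟩
    set p := withNumeraire (L := L) (mrs (u j) (y j)) with hp
    have hpos : p ∈ posOrthant L :=
      withNumeraire_mem_posOrthant ((hu j).mrs_mem_posOrthant (hy j))
    have hW : ∀ i, IsWalrasian (u i) p (p ⬝ᵥ y i) (y i) := fun i => by
      rw [hp, heq j i]; exact (hu i).isWalrasian_mrs (hy i)
    -- First welfare theorem: at the common prices a dominating allocation costs no less for anyone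
    -- and strictly more for `j`, contradicting equal total resources.
    have hcost : ∑ i, p ⬝ᵥ y i < ∑ i, p ⬝ᵥ z i := by
      refine Finset.sum_lt_sum (fun i _ => ?_) ⟨j, Finset.mem_univ _, ?_⟩
      · exact ((hu i).isHicksian_of_isWalrasian (hW i)).2 _ (posOrthant_subset_orthant (hz i))
          (hle i)
      · by_contra! h
        exact ((hW j).2 _ ⟨posOrthant_subset_orthant (hz j), h⟩).not_gt hj
    rw [← dotProduct_sum, ← dotProduct_sum, hsum] at hcost
    exact hcost.false

theorem paretoParam_spec (hu : ∀ i, IsUtility (u i)) {x : (Fin (L - 1) → ℝ) × (Fin I → ℝ)}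
    (hx : x ∈ posOrthant (L - 1) ×ˢ posOrthant I) (i : Fin I) :
    paretoParam u x i ∈ posOrthant L ∧ mrs (u i) (paretoParam u x i) = x.1 ∧
      u i (paretoParam u x i) = x.2 i :=
  ((hu i).eq_hicks_iff hx.1 (hx.2 i)).1 rfl

theorem paretoParam_mem (hu : ∀ i, IsUtility (u i)) {x : (Fin (L - 1) → ℝ) × (Fin I → ℝ)}
    (hx : x ∈ posOrthant (L - 1) ×ˢ posOrthant I) : paretoParam u x ∈ paretoSet u :=
  (mem_paretoSet_iff_mrs hu).2 ⟨fun i => (paretoParam_spec hu hx i).1, fun i j => by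
    rw [(paretoParam_spec hu hx i).2.1, (paretoParam_spec hu hx j).2.1]⟩

variable [NeZero I]

/-- The supporting prices and the utility levels of an allocation. -/
noncomputable def paretoCoord (u : Fin I → (Fin L → ℝ) → ℝ) (y : Fin I → Fin L → ℝ) :
    (Fin (L - 1) → ℝ) × (Fin I → ℝ) :=
  (mrs (u 0) (y 0), fun i => u i (y i))

theorem paretoCoord_mem (hu : ∀ i, IsUtility (u i)) {y : Fin I → Fin L → ℝ}
    (hy : y ∈ paretoSet u) : paretoCoord u y ∈ posOrthant (L - 1) ×ˢ posOrthant I :=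
  ⟨(hu 0).mrs_mem_posOrthant (hy.1 0), fun i => (hu i).utility_pos (hy.1 i)⟩

theorem paretoParam_paretoCoord (hu : ∀ i, IsUtility (u i)) {y : Fin I → Fin L → ℝ}
    (hy : y ∈ paretoSet u) : paretoParam u (paretoCoord u y) = y := by
  ext1 i
  have hmem := paretoCoord_mem hu hy
  exact (((hu i).eq_hicks_iff hmem.1 (hmem.2 i)).2
    ⟨hy.1 i, ((mem_paretoSet_iff_mrs hu).1 hy).2 i 0, rfl⟩).symm

theorem paretoCoord_paretoParam (hu : ∀ i, IsUtility (u i))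
    {x : (Fin (L - 1) → ℝ) × (Fin I → ℝ)} (hx : x ∈ posOrthant (L - 1) ×ˢ posOrthant I) :
    paretoCoord u (paretoParam u x) = x :=
  Prod.ext (paretoParam_spec hu hx 0).2.1 (funext fun i => (paretoParam_spec hu hx i).2.2)

theorem paretoSet_eq_image (hu : ∀ i, IsUtility (u i)) :
    paretoSet u = paretoParam u '' (posOrthant (L - 1) ×ˢ posOrthant I) := by
  ext y
  constructor
  · exact fun hy => ⟨_, paretoCoord_mem hu hy, paretoParam_paretoCoord hu hy⟩
  · rintro ⟨x, hx, rfl⟩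
    exact paretoParam_mem hu hx

theorem continuousOn_paretoCoord (hu : ∀ i, IsUtility (u i)) :
    ContinuousOn (paretoCoord u) (allocations I L) := by
  refine ContinuousOn.prodMk ?_ (continuousOn_pi.2 fun i => ?_)
  · exact (hu 0).contDiffOn_mrs.continuousOn.comp (continuous_apply 0).continuousOn
      fun y hy => hy 0
  · exact (hu i).smooth.continuousOn.comp (continuous_apply i).continuousOn fun y hy => hy i

theorem isConnected_paretoSet (hu : ∀ i, IsUtility (u i)) : IsConnected (paretoSet u) := by
  rw [paretoSet_eq_image hu]
  exact ((convex_posOrthant.prod convex_posOrthant).isConnected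
    (nonempty_posOrthant.prod nonempty_posOrthant)).image _ (continuousOn_paretoParam hu)

/-- The Pareto set is homeomorphic to the set of positive prices and utility levels. -/
noncomputable def paretoHomeomorph (hu : ∀ i, IsUtility (u i)) :
    paretoSet u ≃ₜ (posOrthant (L - 1) ×ˢ posOrthant I :
      Set ((Fin (L - 1) → ℝ) × (Fin I → ℝ))) where
  toFun y := ⟨paretoCoord u y, paretoCoord_mem hu y.2⟩
  invFun x := ⟨paretoParam u x, paretoParam_mem hu x.2⟩
  left_inv y := Subtype.ext (paretoParam_paretoCoord hu y.2)
  right_inv x := Subtype.ext (paretoCoord_paretoParam hu x.2)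
  continuous_toFun := ((continuousOn_paretoCoord hu).mono fun _ hy => hy.1).domRestrict.subtype_mk _
  continuous_invFun := (continuousOn_paretoParam hu).domRestrict.subtype_mk _

/-- The homeomorphism onto an open set of prices and utility levels serves as a single global chart.
-/
theorem isTopSubmanifold_paretoSet (hu : ∀ i, IsUtility (u i)) :
    IsTopSubmanifold (L + I - 1) (paretoSet u) := by
  have : Nonempty (paretoSet u) := (isConnected_paretoSet hu).nonempty.to_subtype
  have hopen : IsOpen (posOrthant (L - 1) ×ˢ posOrthant I :
      Set ((Fin (L - 1) → ℝ) × (Fin I → ℝ))) := isOpen_posOrthant.prod isOpen_posOrthant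
  exact ⟨((coordEquiv L I).toHomeomorph.isOpenEmbedding.comp
    (hopen.isOpenEmbedding_subtypeVal.comp
      (paretoHomeomorph hu).isOpenEmbedding)).singletonChartedSpace⟩

end Pareto

/-! ### The smooth structure under the bordered Hessian condition -/

section Smooth

variable {I L : ℕ} [NeZero L] {u : Fin I → (Fin L → ℝ) → ℝ}

/-- The marginal rates of substitution and the utility levels of all households. -/
noncomputable def mrsUtility (u : Fin I → (Fin L → ℝ) → ℝ) (y : Fin I → Fin L → ℝ) :
    Fin I → (Fin (L - 1) → ℝ) × ℝ :=
  fun i => (mrs (u i) (y i), u i (y i))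

theorem contDiffOn_mrsUtility (hu : ∀ i, IsUtility (u i)) :
    ContDiffOn ℝ ∞ (mrsUtility u) (allocations I L) := by
  refine contDiffOn_pi.2 fun i => ContDiffOn.prodMk ?_ ?_
  · exact (hu i).contDiffOn_mrs.comp (contDiff_apply ℝ _ i).contDiffOn fun y hy => hy i
  · exact (hu i).smooth.comp (contDiff_apply ℝ _ i).contDiffOn fun y hy => hy i

/-- The derivative is block diagonal over households, so injectivity reduces to each one separately.
-/
theorem eq_zero_of_fderiv_mrsUtility_eq_zero (hu : ∀ i, IsUtility (u i))
    (hB : ∀ i, BorderedHessianCondition (u i)) {y : Fin I → Fin L → ℝ}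
    (hy : y ∈ allocations I L) {v : Fin I → Fin L → ℝ} (hv : fderiv ℝ (mrsUtility u) y v = 0) :
    v = 0 := by
  have hF : HasFDerivAt (mrsUtility u) (fderiv ℝ (mrsUtility u) y) y :=
    (((contDiffOn_mrsUtility hu).contDiffAt (isOpen_allocations.mem_nhds hy)).differentiableAt
      (by simp)).hasFDerivAt
  ext1 i
  have hproj : HasFDerivAt (fun y : Fin I → Fin L → ℝ => y i)
      (ContinuousLinearMap.proj (R := ℝ) (φ := fun _ : Fin I => Fin L → ℝ) i) y :=
    hasFDerivAt_apply i y
  have hm : HasFDerivAt (mrs (u i)) (fderiv ℝ (mrs (u i)) (y i)) (y i) :=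
    (((hu i).contDiffOn_mrs.contDiffAt (isOpen_posOrthant.mem_nhds (hy i))).differentiableAt
      (by simp)).hasFDerivAt
  have hG : HasFDerivAt (fun y => mrsUtility u y i) _ y :=
    (hm.comp y hproj).prodMk (((hu i).hasFDerivAt (hy i)).comp y hproj)
  have h := congrArg (fun D => D v) ((hasFDerivAt_pi'.1 hF i).unique hG)
  simp only [ContinuousLinearMap.comp_apply, hv, ContinuousLinearMap.prod_apply] at h
  obtain ⟨h1, h2⟩ := Prod.ext_iff.1 h
  exact (hu i).eq_zero_of_fderiv_mrs_eq_zero (hB i) (hy i) h1.symm h2.symm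

variable [NeZero I]

/-- The slice charts come from the inverse function theorem applied to `mrsUtility`, followed by the
linear splitting whose second component vanishes exactly when all marginal rates agree. -/
theorem isSmoothSubmanifold_paretoSet (hu : ∀ i, IsUtility (u i))
    (hB : ∀ i, BorderedHessianCondition (u i)) :
    IsSmoothSubmanifold (L + I - 1) (paretoSet u) := by
  intro y hyP
  have hy := hyP.1
  set W := {i : Fin I // i ≠ 0} → Fin (L - 1) → ℝ
  set A : (((Fin (L - 1) → ℝ) × (Fin I → ℝ)) × W) ≃L[ℝ] _ :=
    (coordEquiv L I).prodCongr (toEuclidean (E := W))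
  set Λ := A.toContinuousLinearMap ∘L
    (LinearMap.toContinuousLinearMap (splitMap L I))
  have hΛ : Function.Injective Λ := A.injective.comp (splitMap_injective L I)
  set f := fun z => Λ (mrsUtility u z)
  have hf : ContDiffOn ℝ ∞ f (allocations I L) :=
    Λ.contDiff.comp_contDiffOn (contDiffOn_mrsUtility hu)
  -- The count is `I * L = (L + I - 1) + (I - 1) * (L - 1)`; it upgrades injective derivatives to
  -- isomorphisms.
  have hcard : Module.finrank ℝ (Fin I → Fin L → ℝ) = Module.finrank ℝ
      (EuclideanSpace ℝ (Fin (L + I - 1)) × EuclideanSpace ℝ (Fin (Module.finrank ℝ W))) := by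
    obtain ⟨a, rfl⟩ := Nat.exists_eq_succ_of_ne_zero (NeZero.ne L)
    obtain ⟨b, rfl⟩ := Nat.exists_eq_succ_of_ne_zero (NeZero.ne I)
    have hW : Module.finrank ℝ W = b * a := by
      rw [Module.finrank_pi_fintype, Finset.sum_const, Module.finrank_fin_fun]
      simp
    rw [Module.finrank_prod, finrank_euclideanSpace_fin, finrank_euclideanSpace_fin, hW,
      Module.finrank_pi_fintype, Finset.sum_const, Module.finrank_fin_fun]
    simp only [Finset.card_univ, Fintype.card_fin, smul_eq_mul, Nat.succ_eq_add_one]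
    have : a + 1 + (b + 1) - 1 = a + b + 1 := by omega
    rw [this]
    ring
  -- Invertibility is needed at every allocation, not just at `y`, for the inverse chart to be
  -- smooth on its whole target.
  have hderiv : ∀ z ∈ allocations I L, ∃ D : (Fin I → Fin L → ℝ) ≃L[ℝ]
      (EuclideanSpace ℝ (Fin (L + I - 1)) × EuclideanSpace ℝ (Fin (Module.finrank ℝ W))),
      HasFDerivAt f (D : _ →L[ℝ] _) z := by
    intro z hz
    have hG : HasFDerivAt f (Λ ∘L fderiv ℝ (mrsUtility u) z) z :=
      Λ.hasFDerivAt.comp z (((contDiffOn_mrsUtility hu).contDiffAt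
        (isOpen_allocations.mem_nhds hz)).differentiableAt (by simp)).hasFDerivAt
    have hinj : Function.Injective
        (Λ ∘L fderiv ℝ (mrsUtility u) z : _ →L[ℝ] _).toLinearMap := by
      refine (injective_iff_map_eq_zero _).2 fun v hv => ?_
      exact eq_zero_of_fderiv_mrsUtility_eq_zero hu hB hz (hΛ (hv.trans (map_zero Λ).symm))
    refine ⟨(LinearEquiv.ofInjectiveOfFinrankEq _ hinj hcard).toContinuousLinearEquiv, ?_⟩
    convert hG
    exact ContinuousLinearMap.ext fun _ => rfl
  have hcd : ∀ z ∈ allocations I L, ContDiffAt ℝ ∞ f z := fun z hz =>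
    hf.contDiffAt (isOpen_allocations.mem_nhds hz)
  obtain ⟨D, hD⟩ := hderiv y hy
  set Ψ := (hcd y hy).toOpenPartialHomeomorph f hD (by simp)
  have hΨ : ⇑Ψ = f := (hcd y hy).toOpenPartialHomeomorph_coe hD (by simp)
  set Φ := Ψ.restrOpen (allocations I L) isOpen_allocations
  have hΦ : ⇑Φ = f := hΨ
  have hsrc : Φ.source ⊆ allocations I L := fun z hz => by
    simp only [Φ, OpenPartialHomeomorph.restrOpen_source] at hz
    exact hz.2
  refine ⟨Module.finrank ℝ W, Φ, ?_, ?_, ?_, ?_⟩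
  · simp only [Φ, OpenPartialHomeomorph.restrOpen_source]
    exact ⟨(hcd y hy).mem_toOpenPartialHomeomorph_source hD (by simp), hy⟩
  · rw [hΦ]
    exact hf.mono hsrc
  · intro x hx
    have hmem := hsrc (Φ.map_target hx)
    obtain ⟨D', hD'⟩ := hderiv _ hmem
    exact (Φ.contDiffAt_symm hx (hΦ ▸ hD') (hΦ ▸ hcd _ hmem)).contDiffWithinAt
  · intro x hx
    have h2 : (f x).2 = toEuclidean (E := W) fun i => mrs (u i) (x i) - mrs (u 0) (x 0) := rfl
    rw [hΦ, h2, map_eq_zero_iff _ (toEuclidean (E := W)).injective, mem_paretoSet_iff_mrs hu]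
    constructor
    · rintro ⟨-, h⟩
      exact funext fun i => sub_eq_zero.2 (h i 0)
    · intro h
      have h0 : ∀ i, mrs (u i) (x i) = mrs (u 0) (x 0) := fun i => by
        by_cases hi : i = 0
        · rw [hi]
        · exact sub_eq_zero.1 (congrFun h ⟨i, hi⟩)
      exact ⟨hsrc hx, fun i j => (h0 i).trans (h0 j).symm⟩

end Smooth

theorem mainTheorem3 (L I : ℕ) (hL : 2 ≤ L) (hI : 2 ≤ I)
    (u : Fin I → (Fin L → ℝ) → ℝ) (hu : ∀ i, IsUtility (u i)) :
    -- the demand functions are well defined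
    (∀ i, ∀ p ∈ posOrthant L, ∀ w : ℝ, 0 < w → ∃! c, IsWalrasian (u i) p w c) ∧
    (∀ i, ∀ p ∈ posOrthant L, ∀ t : ℝ, 0 < t → ∃! c, IsHicksian (u i) p t c) ∧
    -- the two parametrizations
    paretoSet u =
      {y | ∃ q ∈ posOrthant (L - 1), ∃ t ∈ posOrthant I,
        y = fun i => hicks (u i) (withNumeraire q) (t i)} ∧
    paretoSet u =
      {y | ∃ q ∈ posOrthant (L - 1), ∃ w ∈ posOrthant I,
        y = fun i => hicks (u i) (withNumeraire q)
          (normIndirect (u i) ((w i)⁻¹ • withNumeraire q))} ∧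
    -- the manifold structure
    3 ≤ L + I - 1 ∧
    IsConnected (paretoSet u) ∧
    IsTopSubmanifold (L + I - 1) (paretoSet u) ∧
    ((∀ i, BorderedHessianCondition (u i)) → IsSmoothSubmanifold (L + I - 1) (paretoSet u)) := by
  have : NeZero L := ⟨by omega⟩
  have : NeZero I := ⟨by omega⟩
  have hparam : paretoSet u =
      {y | ∃ q ∈ posOrthant (L - 1), ∃ t ∈ posOrthant I,
        y = fun i => hicks (u i) (withNumeraire q) (t i)} := by
    rw [paretoSet_eq_image hu]
    ext y
    constructor
    · rintro ⟨⟨q, t⟩, ⟨hq, ht⟩, rfl⟩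
      exact ⟨q, hq, t, ht, rfl⟩
    · rintro ⟨q, hq, t, ht, rfl⟩
      exact ⟨(q, t), ⟨hq, ht⟩, rfl⟩
  refine ⟨fun i p hp w hw => ?_, fun i p hp t ht => ?_, hparam, ?_, by omega,
    isConnected_paretoSet hu, isTopSubmanifold_paretoSet hu, isSmoothSubmanifold_paretoSet hu⟩
  · obtain ⟨c, hc⟩ := (hu i).exists_isWalrasian hp hw
    exact ⟨c, hc, fun d hd => (hu i).isWalrasian_unique hp hw hd hc⟩
  · obtain ⟨c, hc⟩ := (hu i).exists_isHicksian hp t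
    exact ⟨c, hc, fun d hd => (hu i).isHicksian_unique hp ht hd hc⟩
  · rw [hparam]
    ext y
    constructor
    · rintro ⟨q, hq, t, ht, rfl⟩
      have hp := withNumeraire_mem_posOrthant (L := L) hq
      -- The wealth of each household is its Hicksian expenditure, whose indirect utility is `t i`.
      refine ⟨q, hq, fun i => withNumeraire q ⬝ᵥ hicks (u i) (withNumeraire q) (t i),
        fun i => (hu i).expenditure_pos hp (ht i) ((hu i).isHicksian_hicks hp _), ?_⟩
      ext1 i
      rw [(hu i).normIndirect_expenditure hp (ht i)]
    · rintro ⟨q, hq, w, hw, rfl⟩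
      exact ⟨q, hq, _, fun i =>
        (hu i).normIndirect_pos (withNumeraire_mem_posOrthant hq) (hw i), rfl⟩
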